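/- **Setting.** A strategy with question sets $\mathcal X=\{0,1,2\}$, $\mathcal Y=\{0,1,2,3\}$ and answer sets $\mathcal A=\mathcal B=\mathbb N$ consists of complex Hilbert spaces $\mathcal H_A,\mathcal H_B$ (of any dimension), a unit vector $|\psi\rangle\in\mathcal H_A\otimes\mathcal H_B$, and, for all $x$ and $y$, projective measurements $\{A_x^a\}_{a\in\mathbb N}$ on $\mathcal H_A$ and $\{B_y^b\}_{b\in\mathbb N}$ on $\mathcal H_B$. It achieves the correlation $p(a,b|x,y)=\langle\psi|A_x^a\otimes B_y^b|\psi\rangle$. Let $\mathcal C_{qs}^{3,4,\infty,\infty}$ be the set of all correlations achieved by strategies, and $\mathcal C_{q\le N}^{3,4,\infty,\infty}$ the set of those achieved by a strategy whose state has Schmidt rank at most $N$. Put $|p-p'|_{corr}=\sup_{x,y}\sum_{a,b}|p(a,b|x,y)-p'(a,b|x,y)|$. **The correlations $p^*_d$.** Let $d=2K+1$ and $|\Psi_d\rangle=\sum_{i=0}^{d-1}c_i|ii\rangle$ with $c_i=C_d\,(i+1)^{-8}$, $C_d=\big(\sum_{j=1}^{d}j^{-16}\big)^{-1/2}$. Let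 $\theta_m=\arctan\frac{c_{2m+1}}{c_{2m}}$, $\mu_m=\arctan(\sin 2\theta_m)$, $\theta'_m=\arctan\frac{c_{2m+2}}{c_{2m+1}}$, $\mu'_m=\arctan(\sin 2\theta'_m)$. For a $2\times 2$ observable $O$ write $[O]_m$ and $[O]'_m$ for $O$ acting on the span of $\{|2m\rangle,|2m+1\rangle\}$ and of $\{|2m+1\rangle,|2m+2\rangle\}$. Let $p^*_d$ be the correlation with answers $\{0,\dots,d-1\}$ obtained by measuring $|\Psi_d\rangle$ as follows. For $x=0$ Alice measures in the computational basis; for $x=1,2$ in the eigenbases of $\bigoplus_{m<K}[\sigma_X]_m\oplus|2K\rangle\langle 2K|$ and $|0\rangle\langle 0|\oplus\bigoplus_{m<K}[\sigma_X]'_m$. For $y=0,1$ Bob measures in the eigenbases of $\bigoplus_{m<K}[\cos\mu_m\,\sigma_Z\pm\sin\mu_m\,\sigma_X]_m\oplus|2K\rangle\langle 2K|$; for $y=2,3$ in those of $|0\rangle\langle 0|\oplus\bigoplus_{m<K}[\cos\mu'_m\,\sigma_Z\pm\sin\mu'_m\,\sigma_X]'_m$ (sign $+$ for $y=0,2$,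 sign $-$ for $y=1,3$). Each eigenbasis is adapted to the blocks, and in each block the eigenvectors of eigenvalue $+1,-1$ carry the first and the second of the two labels of the block; the vectors $|2K\rangle$ and $|0\rangle$ outside the blocks carry the labels $2K$ and $0$. Let $\hat p^*_d$ be the extension of $p^*_d$ by zero to answers in $\mathbb N$. **Theorem.** There is a correlation $p^*\in\mathcal C_{qs}^{3,4,\infty,\infty}$, namely the pointwise limit $p^*=\lim_{K\to\infty}\hat p^*_{2K+1}$, and a constant $C>0$ such that for all $N\in\mathbb N$ and $\delta>0$: if $p\in\mathcal C_{q\le N}^{3,4,\infty,\infty}$ and $|p-p^*|_{corr}\le\delta$, then $N\ge C\,\delta^{-1/32}$. That is, $N=\Omega(\delta^{-1/32})$. -/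

import Mathlib

open scoped TensorProduct InnerProductSpace ENNReal

universe u v

noncomputable section

/-! ### Hilbert space tensor products -/

/-- The Hilbert space tensor product of `H` and `K`: the completion of the algebraic tensor product
with respect to the inner product `⟪a ⊗ b, c ⊗ d⟫ = ⟪a, c⟫ * ⟪b, d⟫`. -/
abbrev HilbertTensor (H : Type u) (K : Type v)
    [NormedAddCommGroup H] [InnerProductSpace ℂ H]
    [NormedAddCommGroup K] [InnerProductSpace ℂ K] : Type (max u v) :=
  UniformSpace.Completion (H ⊗[ℂ] K)

/-- The product vector `x ⊗ y` in the Hilbert space tensor product. -/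
def hilbertTmul {H : Type u} {K : Type v}
    [NormedAddCommGroup H] [InnerProductSpace ℂ H]
    [NormedAddCommGroup K] [InnerProductSpace ℂ K] (x : H) (y : K) : HilbertTensor H K :=
  ((x ⊗ₜ[ℂ] y : H ⊗[ℂ] K) : UniformSpace.Completion (H ⊗[ℂ] K))

/-- The bounded operator `S ⊗ T` on the Hilbert space tensor product: the continuous extension of
`x ⊗ y ↦ S x ⊗ T y`. -/
def hilbertTensorMap {H : Type u} {K : Type v}
    [NormedAddCommGroup H] [InnerProductSpace ℂ H]
    [NormedAddCommGroup K] [InnerProductSpace ℂ K] (S : H →L[ℂ] H) (T : K →L[ℂ] K) :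
    HilbertTensor H K →L[ℂ] HilbertTensor H K :=
  (TensorProduct.mapL S T).completion

/-- `ψ` has Schmidt rank at most `N`: it has a Schmidt decomposition
`ψ = ∑_{i < r} lam i • (e i ⊗ f i)` with `r ≤ N` positive Schmidt coefficients `lam i` and
orthonormal families `e`, `f`. -/
def SchmidtRankLE {H : Type u} {K : Type v}
    [NormedAddCommGroup H] [InnerProductSpace ℂ H]
    [NormedAddCommGroup K] [InnerProductSpace ℂ K] (ψ : HilbertTensor H K) (N : ℕ) : Prop :=
  ∃ r : ℕ, r ≤ N ∧ ∃ (lam : Fin r → ℝ) (e : Fin r → H) (f : Fin r → K),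
    (∀ i, 0 < lam i) ∧ Orthonormal ℂ e ∧ Orthonormal ℂ f ∧
      ψ = ∑ i, (lam i : ℂ) • hilbertTmul (e i) (f i)

/-! ### Measurements, strategies and correlation sets -/

/-- A projective measurement with outcomes in `A`: mutually orthogonal projections that sum to the
identity (in the strong operator topology, if `A` is infinite). -/
structure IsProjectiveMeasurement {A : Type} {H : Type u}
    [NormedAddCommGroup H] [InnerProductSpace ℂ H] [CompleteSpace H]
    (P : A → H →L[ℂ] H) : Prop where
  isStarProjection : ∀ a, IsStarProjection (P a)
  orthogonal : ∀ a a', a ≠ a' → P a * P a' = 0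
  hasSum_apply : ∀ h : H, HasSum (fun a => P a h) h

/-- A bipartite strategy: a unit vector in the tensor product of two Hilbert spaces, and, for each
question, a projective measurement on the respective tensor factor. -/
structure Strategy (X Y A B : Type) (H : Type u) (K : Type v)
    [NormedAddCommGroup H] [InnerProductSpace ℂ H] [CompleteSpace H]
    [NormedAddCommGroup K] [InnerProductSpace ℂ K] [CompleteSpace K] where
  state : HilbertTensor H K
  norm_state : ‖state‖ = 1
  alice : X → A → H →L[ℂ] H
  bob : Y → B → K →L[ℂ] K
  alice_isPVM : ∀ x, IsProjectiveMeasurement (alice x)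
  bob_isPVM : ∀ y, IsProjectiveMeasurement (bob y)

/-- The strategy achieves the correlation `p`, where `p x y a b` stands for `p(a,b|x,y)`:
`p(a,b|x,y) = ⟨ψ| A_x^a ⊗ B_y^b |ψ⟩`. -/
def Strategy.Achieves {X Y A B : Type} {H : Type u} {K : Type v}
    [NormedAddCommGroup H] [InnerProductSpace ℂ H] [CompleteSpace H]
    [NormedAddCommGroup K] [InnerProductSpace ℂ K] [CompleteSpace K]
    (S : Strategy X Y A B H K) (p : X → Y → A → B → ℝ) : Prop :=
  ∀ x y a b,
    (p x y a b : ℂ) = ⟪S.state, hilbertTensorMap (S.alice x a) (S.bob y b) S.state⟫_ℂ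

/-- `C_qs` for question sets `X`, `Y` and answer sets `A`, `B`: the correlations that are achieved
by some strategy on a tensor product of two (possibly infinite-dimensional) Hilbert spaces. -/
def Cqs (X Y A B : Type) : Set (X → Y → A → B → ℝ) :=
  {p | ∃ (H : Type u) (_ : NormedAddCommGroup H) (_ : InnerProductSpace ℂ H) (_ : CompleteSpace H)
      (K : Type v) (_ : NormedAddCommGroup K) (_ : InnerProductSpace ℂ K) (_ : CompleteSpace K)
      (S : Strategy X Y A B H K), S.Achieves p}

/-- `C_{q ≤ N}`: the correlations that are achieved by some strategy whose state has Schmidt rank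
at most `N` (the Hilbert spaces may be infinite-dimensional). -/
def CqLE (X Y A B : Type) (N : ℕ) : Set (X → Y → A → B → ℝ) :=
  {p | ∃ (H : Type u) (_ : NormedAddCommGroup H) (_ : InnerProductSpace ℂ H) (_ : CompleteSpace H)
      (K : Type v) (_ : NormedAddCommGroup K) (_ : InnerProductSpace ℂ K) (_ : CompleteSpace K)
      (S : Strategy X Y A B H K), SchmidtRankLE S.state N ∧ S.Achieves p}

/-- The distance `sup_{x,y} ∑_{a,b} |p(a,b|x,y) - p'(a,b|x,y)|`, as an extended nonnegative real,
so that infinite sums and suprema have their true value. -/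
def corrDist {X Y A B : Type} (p p' : X → Y → A → B → ℝ) : ℝ≥0∞ :=
  ⨆ (x : X) (y : Y), ∑' ab : A × B, ENNReal.ofReal |p x y ab.1 ab.2 - p' x y ab.1 ab.2|

/-! ### The finite ideal correlations, for local dimension `d = 2 * K + 1` -/

/-- The computational basis vector `|i⟩`. -/
def ket {d : ℕ} (i : Fin d) : EuclideanSpace ℂ (Fin d) :=
  EuclideanSpace.single i 1

/-- Matrix element `⟨i|w_a⟩` of the eigenbasis `(w_a)` of
`⨁_m (cos (φ m) σ_Z + sin (φ m) σ_X)` on the blocks `{|2m⟩, |2m+1⟩}`. Outcome `a = 2m` is the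
eigenvector `cos (φ m / 2) |2m⟩ + sin (φ m / 2) |2m+1⟩` of eigenvalue `1`, and outcome `a = 2m+1`
the eigenvector `- sin (φ m / 2) |2m⟩ + cos (φ m / 2) |2m+1⟩` of eigenvalue `-1`. -/
def blockEntry (φ : ℕ → ℝ) (a i : ℕ) : ℝ :=
  if a % 2 = 0 then
    if i = a then Real.cos (φ (a / 2) / 2)
    else if i = a + 1 then Real.sin (φ (a / 2) / 2)
    else 0
  else
    if i = a then Real.cos (φ (a / 2) / 2)
    else if i + 1 = a then -Real.sin (φ (a / 2) / 2)
    else 0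

/-- The eigenbasis of `⨁_{m < K} [cos (φ m) σ_Z + sin (φ m) σ_X]_m ⊕ |2K⟩⟨2K|` in dimension
`2K+1`, where `[·]_m` acts on `{|2m⟩, |2m+1⟩}`; outcome `2K` is the vector `|2K⟩`. -/
def blockVec (K : ℕ) (φ : ℕ → ℝ) (a : Fin (2 * K + 1)) : EuclideanSpace ℂ (Fin (2 * K + 1)) :=
  if (a : ℕ) = 2 * K then ket a
  else WithLp.toLp 2 fun i => (blockEntry φ a i : ℂ)

/-- The eigenbasis of `|0⟩⟨0| ⊕ ⨁_{m < K} [cos (φ m) σ_Z + sin (φ m) σ_X]'_m` in dimension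
`2K+1`, where `[·]'_m` acts on `{|2m+1⟩, |2m+2⟩}`; outcome `0` is the vector `|0⟩`, and outcomes
`2m+1`, `2m+2` are the eigenvectors of eigenvalue `1`, `-1` in the block `m`. -/
def shiftedBlockVec (K : ℕ) (φ : ℕ → ℝ) (a : Fin (2 * K + 1)) :
    EuclideanSpace ℂ (Fin (2 * K + 1)) :=
  if (a : ℕ) = 0 then ket a
  else WithLp.toLp 2 fun i =>
    if (i : ℕ) = 0 then 0 else (blockEntry φ ((a : ℕ) - 1) ((i : ℕ) - 1) : ℂ)

/-- `μ_m = arctan (sin (2 θ_m))` with `θ_m = arctan (c_{2m+1} / c_{2m})`. -/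
def angleMu (c : ℕ → ℝ) (m : ℕ) : ℝ :=
  Real.arctan (Real.sin (2 * Real.arctan (c (2 * m + 1) / c (2 * m))))

/-- `μ'_m = arctan (sin (2 θ'_m))` with `θ'_m = arctan (c_{2m+2} / c_{2m+1})`. -/
def angleMu' (c : ℕ → ℝ) (m : ℕ) : ℝ :=
  Real.arctan (Real.sin (2 * Real.arctan (c (2 * m + 2) / c (2 * m + 1))))

/-- Alice's measurement bases: the computational basis for `x = 0`, and the eigenbases of
`⨁_m [σ_X]_m ⊕ |2K⟩⟨2K|` for `x = 1` and of `|0⟩⟨0| ⊕ ⨁_m [σ_X]'_m` for `x = 2`. -/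
def aliceBasis (K : ℕ) : Fin 3 → Fin (2 * K + 1) → EuclideanSpace ℂ (Fin (2 * K + 1)) :=
  ![ket, blockVec K fun _ => Real.pi / 2, shiftedBlockVec K fun _ => Real.pi / 2]

/-- Bob's measurement bases: the eigenbases of `⨁_m [cos μ_m σ_Z ± sin μ_m σ_X]_m ⊕ |2K⟩⟨2K|`
for `y = 0, 1` and of `|0⟩⟨0| ⊕ ⨁_m [cos μ'_m σ_Z ± sin μ'_m σ_X]'_m` for `y = 2, 3`. -/
def bobBasis (K : ℕ) (c : ℕ → ℝ) :
    Fin 4 → Fin (2 * K + 1) → EuclideanSpace ℂ (Fin (2 * K + 1)) :=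
  ![blockVec K (angleMu c), blockVec K fun m => -angleMu c m,
    shiftedBlockVec K (angleMu' c), shiftedBlockVec K fun m => -angleMu' c m]

/-- The state `∑_{i ≤ 2K} c_i |i⟩ ⊗ |i⟩`. -/
def idealState (K : ℕ) (c : ℕ → ℝ) :
    EuclideanSpace ℂ (Fin (2 * K + 1)) ⊗[ℂ] EuclideanSpace ℂ (Fin (2 * K + 1)) :=
  ∑ i : Fin (2 * K + 1), (c i : ℂ) • (ket i ⊗ₜ[ℂ] ket i)

/-- The ideal correlation for the state `∑_{i ≤ 2K} c_i |i⟩ ⊗ |i⟩`: both parties measure in the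
bases above, so `p(a,b|x,y) = |⟨u_{x,a} ⊗ v_{y,b} | Ψ⟩|²`. -/
def idealCorr (K : ℕ) (c : ℕ → ℝ) :
    Fin 3 → Fin 4 → Fin (2 * K + 1) → Fin (2 * K + 1) → ℝ :=
  fun x y a b => ‖⟪aliceBasis K x a ⊗ₜ[ℂ] bobBasis K c y b, idealState K c⟫_ℂ‖ ^ 2

/-- The lift of a correlation with `d` answers per party to answers in `ℕ`: all the answers outside
`{0, …, d-1}` get probability zero. -/
def liftCorr {X Y : Type} {d : ℕ} (p : X → Y → Fin d → Fin d → ℝ) : X → Y → ℕ → ℕ → ℝ :=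
  fun x y a b => if h : a < d ∧ b < d then p x y ⟨a, h.1⟩ ⟨b, h.2⟩ else 0

/-- The normalized coefficients `C_d / (i+1)^8`, with `C_d = (∑_{j < d} 1 / (j+1)^16)^{-1/2}`. -/
def powerCoeff (d i : ℕ) : ℝ :=
  (1 / ((i : ℝ) + 1) ^ 8) / Real.sqrt (∑ j ∈ Finset.range d, 1 / ((j : ℝ) + 1) ^ 16)

end

/-! The lower bound needs only the questions $x=y=0$ and even answers; no self-testing is involved.
Write $c_i$ for the limit coefficients. Bob's vector with label $2n$ is supported on $\{2n,2n+1\}$,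
so $p^*(2m,2n|0,0)$ vanishes for $m\ne n$, while the diagonal entry is $c_{2m}^2\cos^2(\mu_m/2)\ge
c_{2m}^2/2$.

A tensor $\tau$ of rank $r$ cannot imitate $r+1$ such diagonal blocks (`diagonal_le_of_rank_le`). In
block $m$, choose a product vector $s_m\otimes t_m$ whose squared overlap with $\tau$ is at least
$1/r$ of the squared norm of that block. The matrix $\langle s_m\otimes t_n,\tau\rangle$ has size
$r+1$ and rank at most $r$, so it is singular and not strictly diagonally dominant. If the
off-diagonal blocks have squared norm at most $\varepsilon$, some diagonal entry is at most
$r\sqrt\varepsilon$, and its block has squared norm at most $r^3\varepsilon$. With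
$\varepsilon=\delta$ this gives $c_{2N}^2/2\le(N^3+1)\delta$; as $c_{2N}^2\sim N^{-16}$ up to a
constant, $N^{19}\gtrsim\delta^{-1}$, which exceeds the claim.

For the existence of $p^*$, all the measurement bases are rows of banded orthogonal matrices, which
also act on $\ell^2$. Bob's angles depend only on ratios of coefficients, hence not on $d$. Each
amplitude is thus a finite sum in which only the normalization $C_d$ varies, and the limit is
achieved by $\sum_i c_i\,e_i\otimes e_i$. -/

/-! ### Norms of block components of a tensor of low rank -/

section LowRank

variable {H : Type u} {K : Type v} [NormedAddCommGroup H] [InnerProductSpace ℂ H]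
  [NormedAddCommGroup K] [InnerProductSpace ℂ K]

/-- A tensor of rank at most `r` has overlap at least `‖T‖ / √r` with some product vector `s ⊗ t`
of norm at most one. -/
theorem exists_norm_sq_le_inner_tmul {r : ℕ} (x : Fin r → H) (y : Fin r → K) :
    ∃ s ∈ Submodule.span ℂ (Set.range x), ∃ t ∈ Submodule.span ℂ (Set.range y),
      ‖s‖ ≤ 1 ∧ ‖t‖ ≤ 1 ∧
      ‖∑ k, x k ⊗ₜ[ℂ] y k‖ ^ 2 ≤ r * ‖⟪s ⊗ₜ[ℂ] t, ∑ k, x k ⊗ₜ[ℂ] y k⟫_ℂ‖ ^ 2 := by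
  set V := Submodule.span ℂ (Set.range x) with hV
  have hfin : FiniteDimensional ℂ V := FiniteDimensional.span_of_finite ℂ (Set.finite_range x)
  have hrank : Module.finrank ℂ V ≤ r := by
    exact (finrank_range_le_card (R := ℂ) x).trans_eq (Fintype.card_fin r)
  let b := stdOrthonormalBasis ℂ V
  let x' : Fin r → V := fun k => ⟨x k, Submodule.subset_span ⟨k, rfl⟩⟩
  let t : Fin (Module.finrank ℂ V) → K := fun i => ∑ k, ⟪b i, x' k⟫_ℂ • y k
  -- Orthonormal left factors make the at most $r$ summands orthogonal, so by Pythagoras the largest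
  -- carries at least $1/r$ of the squared norm.
  have hT : ∑ k, x k ⊗ₜ[ℂ] y k = ∑ i, (b i : H) ⊗ₜ[ℂ] t i := by
    have hx : ∀ k, x k = ∑ i, ⟪b i, x' k⟫_ℂ • (b i : H) := by
      intro k
      have := congrArg (Subtype.val) (b.sum_repr' (x' k))
      simpa using this.symm
    calc ∑ k, x k ⊗ₜ[ℂ] y k = ∑ k, ∑ i, ⟪b i, x' k⟫_ℂ • ((b i : H) ⊗ₜ[ℂ] y k) := by
          refine Finset.sum_congr rfl fun k _ => ?_
          conv_lhs => rw [hx k]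
          simp [TensorProduct.sum_tmul, TensorProduct.smul_tmul']
      _ = _ := by
          rw [Finset.sum_comm]
          simp [t, TensorProduct.tmul_sum, TensorProduct.tmul_smul]
  have hinner : ∀ i z, ⟪(b i : H) ⊗ₜ[ℂ] z, ∑ k, x k ⊗ₜ[ℂ] y k⟫_ℂ = ⟪z, t i⟫_ℂ := by
    intro i z
    rw [hT, inner_sum, Finset.sum_eq_single i]
    · have := orthonormal_iff_ite.1 b.orthonormal i i
      simp only [Submodule.coe_inner, if_true] at this
      simp only [TensorProduct.inner_tmul, this, one_mul]
    · intro j _ hj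
      have := orthonormal_iff_ite.1 b.orthonormal i j
      simp only [Submodule.coe_inner, if_neg hj.symm] at this
      simp only [TensorProduct.inner_tmul, this, zero_mul]
    · simp
  have hnorm : ‖∑ k, x k ⊗ₜ[ℂ] y k‖ ^ 2 = ∑ i, ‖t i‖ ^ 2 := by
    have h1 : ⟪∑ k, x k ⊗ₜ[ℂ] y k, ∑ k, x k ⊗ₜ[ℂ] y k⟫_ℂ = ∑ i, ⟪t i, t i⟫_ℂ := by
      conv_lhs => lhs; rw [hT]
      rw [sum_inner]
      exact Finset.sum_congr rfl fun i _ => hinner i (t i)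
    rw [← inner_self_eq_norm_sq (𝕜 := ℂ), h1, map_sum]
    exact Finset.sum_congr rfl fun i _ => inner_self_eq_norm_sq _
  rcases isEmpty_or_nonempty (Fin (Module.finrank ℂ V)) with he | he
  · refine ⟨0, zero_mem _, 0, zero_mem _, by simp, by simp, ?_⟩
    rw [hnorm]
    simp
  obtain ⟨i, -, hi⟩ := Finset.exists_max_image Finset.univ (fun i => ‖t i‖) Finset.univ_nonempty
  -- If `t i = 0`, the inverse is zero and so is the second factor; hence norm at most one rather
  -- than equal to one.
  refine ⟨b i, (b i).2, ((‖t i‖⁻¹ : ℝ) : ℂ) • t i, ?_, ?_, ?_, ?_⟩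
  · exact Submodule.smul_mem _ _ (Submodule.sum_mem _ fun k _ =>
      Submodule.smul_mem _ _ (Submodule.subset_span ⟨k, rfl⟩))
  · exact (b.orthonormal.1 i).le
  · rw [norm_smul]
    simp only [Complex.norm_real, norm_inv, norm_norm]
    exact inv_mul_le_one
  · have h2 : ‖⟪((‖t i‖⁻¹ : ℝ) : ℂ) • t i, t i⟫_ℂ‖ = ‖t i‖ := by
      rw [inner_smul_left, inner_self_eq_norm_sq_to_K, Complex.conj_ofReal]
      rcases eq_or_ne (‖t i‖) 0 with h | h
      · simp [h]
      · have : ((‖t i‖⁻¹ : ℝ) : ℂ) * ((‖t i‖ : ℝ) : ℂ) ^ 2 = ((‖t i‖ : ℝ) : ℂ) := by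
          have : ((‖t i‖ : ℝ) : ℂ) ≠ 0 := by exact_mod_cast h
          push_cast
          field_simp
        erw [this]
        simp
    rw [hinner, h2, hnorm]
    calc ∑ j, ‖t j‖ ^ 2 ≤ ∑ _j : Fin (Module.finrank ℂ V), ‖t i‖ ^ 2 :=
          Finset.sum_le_sum fun j hj => by
            have := hi j hj
            gcongr
      _ = (Module.finrank ℂ V : ℝ) * ‖t i‖ ^ 2 := by simp
      _ ≤ r * ‖t i‖ ^ 2 := by gcongr

variable [CompleteSpace H] [CompleteSpace K]

theorem inner_mapL_eq_inner_mapL {P : H →L[ℂ] H} {Q : K →L[ℂ] K} (hP : IsSelfAdjoint P)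
    (hQ : IsSelfAdjoint Q) (x y : H ⊗[ℂ] K) :
    ⟪TensorProduct.mapL P Q x, y⟫_ℂ = ⟪x, TensorProduct.mapL P Q y⟫_ℂ := by
  induction x with
  | zero => simp
  | add a b ha hb => simp only [map_add, inner_add_left, ha, hb]
  | tmul a b =>
    induction y with
    | zero => simp
    | add c d hc hd => simp only [map_add, inner_add_right, hc, hd]
    | tmul c d =>
      have h1 := (ContinuousLinearMap.isSelfAdjoint_iff_isSymmetric.1 hP) a c
      have h2 := (ContinuousLinearMap.isSelfAdjoint_iff_isSymmetric.1 hQ) b d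
      simp only [ContinuousLinearMap.coe_coe] at h1 h2
      simp [TensorProduct.mapL_apply, h1, h2]

/-- This turns outcome probabilities into squared norms of block components, the form used in the
rank argument. -/
theorem norm_sq_mapL_eq_inner {P : H →L[ℂ] H} {Q : K →L[ℂ] K} (hP : IsStarProjection P)
    (hQ : IsStarProjection Q) (x : H ⊗[ℂ] K) :
    ((‖TensorProduct.mapL P Q x‖ ^ 2 : ℝ) : ℂ) = ⟪x, TensorProduct.mapL P Q x⟫_ℂ := by
  have h : TensorProduct.mapL P Q (TensorProduct.mapL P Q x) = TensorProduct.mapL P Q x := by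
    induction x with
    | zero => simp
    | add a b ha hb => simp only [map_add, ha, hb]
    | tmul a b =>
      have h1 : P (P a) = P a := DFunLike.congr_fun hP.isIdempotentElem.eq a
      have h2 : Q (Q b) = Q b := DFunLike.congr_fun hQ.isIdempotentElem.eq b
      simp [TensorProduct.mapL_apply, h1, h2]
  have h3 := inner_mapL_eq_inner_mapL hP.isSelfAdjoint hQ.isSelfAdjoint x
    (TensorProduct.mapL P Q x)
  rw [h, inner_self_eq_norm_sq_to_K] at h3
  rw [← h3]
  push_cast
  rfl

/-- A tensor of rank `r` cannot have `r + 1` diagonal components (with respect to projections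
`P m ⊗ Q n`) that are much larger than all the off-diagonal components. -/
theorem diagonal_le_of_rank_le {r : ℕ} (x : Fin r → H) (y : Fin r → K)
    (P : Fin (r + 1) → H →L[ℂ] H) (Q : Fin (r + 1) → K →L[ℂ] K)
    (hP : ∀ m, IsStarProjection (P m)) (hQ : ∀ m, IsStarProjection (Q m)) {w ε : ℝ} (hε : 0 ≤ ε)
    (hdiag : ∀ m, w ≤ ‖TensorProduct.mapL (P m) (Q m) (∑ k, x k ⊗ₜ[ℂ] y k)‖ ^ 2)
    (hoff : ∀ m n, m ≠ n → ‖TensorProduct.mapL (P m) (Q n) (∑ k, x k ⊗ₜ[ℂ] y k)‖ ^ 2 ≤ ε) :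
    w ≤ r ^ 3 * ε := by
  set τ := ∑ k, x k ⊗ₜ[ℂ] y k with hτ
  have hmap : ∀ m n, TensorProduct.mapL (P m) (Q n) τ = ∑ k, P m (x k) ⊗ₜ[ℂ] Q n (y k) := by
    intro m n
    simp [hτ, map_sum, TensorProduct.mapL_apply]
  -- Since `s m` and `t n` are fixed by their projections, pairing `s m ⊗ t n` with `τ` sees only
  -- the block `(m, n)`.
  have hfixP : ∀ m, ∀ s ∈ Submodule.span ℂ (Set.range fun k => P m (x k)), P m s = s := by
    intro m s hs
    have : Submodule.span ℂ (Set.range fun k => P m (x k)) ≤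
        LinearMap.eqLocus (P m : H →ₗ[ℂ] H) LinearMap.id := by
      rw [Submodule.span_le]
      rintro _ ⟨k, rfl⟩
      exact DFunLike.congr_fun (hP m).isIdempotentElem.eq (x k)
    exact this hs
  have hfixQ : ∀ m, ∀ t ∈ Submodule.span ℂ (Set.range fun k => Q m (y k)), Q m t = t := by
    intro m s hs
    have : Submodule.span ℂ (Set.range fun k => Q m (y k)) ≤
        LinearMap.eqLocus (Q m : K →ₗ[ℂ] K) LinearMap.id := by
      rw [Submodule.span_le]
      rintro _ ⟨k, rfl⟩
      exact DFunLike.congr_fun (hQ m).isIdempotentElem.eq (y k)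
    exact this hs
  choose s hs t ht hs1 ht1 hst using fun m : Fin (r + 1) =>
    exists_norm_sq_le_inner_tmul (fun k => P m (x k)) (fun k => Q m (y k))
  have hG : ∀ m n, ⟪s m ⊗ₜ[ℂ] t n, τ⟫_ℂ =
      ⟪s m ⊗ₜ[ℂ] t n, TensorProduct.mapL (P m) (Q n) τ⟫_ℂ := by
    intro m n
    rw [← inner_mapL_eq_inner_mapL (hP m).isSelfAdjoint (hQ n).isSelfAdjoint]
    simp [TensorProduct.mapL_apply, hfixP m _ (hs m), hfixQ n _ (ht n)]
  let G : Matrix (Fin (r + 1)) (Fin (r + 1)) ℂ := fun m n => ⟪s m ⊗ₜ[ℂ] t n, τ⟫_ℂ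
  have hdet : G.det = 0 := by
    by_contra hne
    have h1 : G.rank = r + 1 := by
      simpa using Matrix.rank_of_isUnit G ((Matrix.isUnit_iff_isUnit_det G).2 (Ne.isUnit hne))
    have h2 : G = (Matrix.of fun m k => ⟪s m, x k⟫_ℂ : Matrix (Fin (r + 1)) (Fin r) ℂ) *
        (Matrix.of fun k n => ⟪t n, y k⟫_ℂ : Matrix (Fin r) (Fin (r + 1)) ℂ) := by
      ext m n
      simp [G, hτ, inner_sum, Matrix.mul_apply]
    have h3 : G.rank ≤ r := by
      rw [h2]
      refine (Matrix.rank_mul_le_left _ _).trans ?_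
      simpa using Matrix.rank_le_card_width
        (Matrix.of fun m k => ⟪s m, x k⟫_ℂ : Matrix (Fin (r + 1)) (Fin r) ℂ)
    omega
  -- Lévy–Desplanques: a strictly diagonally dominant matrix is invertible.
  obtain ⟨m, hm⟩ : ∃ m, ‖G m m‖ ≤ ∑ n ∈ Finset.univ.erase m, ‖G m n‖ := by
    by_contra! h
    exact det_ne_zero_of_sum_row_lt_diag h hdet
  have hGoff : ∀ n ∈ Finset.univ.erase m, ‖G m n‖ ≤ √ε := by
    intro n hn
    have hn' : m ≠ n := (Finset.ne_of_mem_erase hn).symm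
    calc ‖G m n‖ ≤ ‖s m ⊗ₜ[ℂ] t n‖ * ‖TensorProduct.mapL (P m) (Q n) τ‖ := by
          simp only [G]
          rw [hG]
          exact norm_inner_le_norm (𝕜 := ℂ) (s m ⊗ₜ[ℂ] t n) _
      _ ≤ 1 * ‖TensorProduct.mapL (P m) (Q n) τ‖ := by
          gcongr
          rw [TensorProduct.norm_tmul]
          exact mul_le_one₀ (hs1 m) (norm_nonneg _) (ht1 n)
      _ ≤ √ε := by
          rw [one_mul]
          exact Real.le_sqrt_of_sq_le (hoff m n hn')
  have hGm : ‖G m m‖ ≤ r * √ε := by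
    refine hm.trans ((Finset.sum_le_card_nsmul _ _ _ hGoff).trans_eq ?_)
    simp
  calc w ≤ ‖TensorProduct.mapL (P m) (Q m) τ‖ ^ 2 := hdiag m
    _ ≤ r * ‖G m m‖ ^ 2 := by
        simp only [G]
        rw [hG, hmap]
        exact hst m
    _ ≤ r * (r * √ε) ^ 2 := by gcongr
    _ = r ^ 3 * ε := by rw [mul_pow, Real.sq_sqrt hε]; ring

/-- The diagonal of a table of probabilities achieved by a state of Schmidt rank at most `N` is not
much larger than the off-diagonal entries. -/
theorem diagonal_le_of_schmidtRankLE {N : ℕ} {ψ : HilbertTensor H K} (hψ : SchmidtRankLE ψ N)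
    (P : ℕ → H →L[ℂ] H) (Q : ℕ → K →L[ℂ] K)
    (hP : ∀ m, IsStarProjection (P m)) (hQ : ∀ m, IsStarProjection (Q m)) (q : ℕ → ℕ → ℝ)
    (hq : ∀ m n, (q m n : ℂ) = ⟪ψ, hilbertTensorMap (P m) (Q n) ψ⟫_ℂ) {w ε : ℝ} (hε : 0 ≤ ε)
    (hdiag : ∀ m ≤ N, w ≤ q m m) (hoff : ∀ m n, m ≠ n → q m n ≤ ε) :
    w ≤ N ^ 3 * ε := by
  obtain ⟨r, hr, lam, e, f, -, -, -, rfl⟩ := hψ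
  -- A state of finite Schmidt rank already lies in the algebraic tensor product, so the completion
  -- can be left behind.
  set τ : H ⊗[ℂ] K := ∑ i, ((lam i : ℂ) • e i) ⊗ₜ[ℂ] f i with hτ
  have hcoe : (∑ i, (lam i : ℂ) • hilbertTmul (e i) (f i)) = ((τ : H ⊗[ℂ] K) : HilbertTensor H K) := by
    have : ∀ z : H ⊗[ℂ] K, (z : HilbertTensor H K) = UniformSpace.Completion.toComplL (𝕜 := ℂ) (E := H ⊗[ℂ] K) z :=
      fun z => rfl
    simp only [hilbertTmul, this, hτ, map_sum, ← TensorProduct.smul_tmul', map_smul]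
  have hq' : ∀ m n, q m n = ‖TensorProduct.mapL (P m) (Q n) τ‖ ^ 2 := by
    intro m n
    have h := hq m n
    rw [hcoe, hilbertTensorMap, ContinuousLinearMap.completion_apply_coe,
      UniformSpace.Completion.inner_coe, ← norm_sq_mapL_eq_inner (hP m) (hQ n)] at h
    exact_mod_cast h
  refine (diagonal_le_of_rank_le (fun k => (lam k : ℂ) • e k) f (fun m => P m) (fun m => Q m)
    (fun m => hP m) (fun m => hQ m) hε (fun m => ?_) (fun m n hmn => ?_)).trans
    (b := (r : ℝ) ^ 3 * ε) (by gcongr)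
  · rw [← hτ, ← hq']
    exact hdiag _ (by omega)
  · rw [← hτ, ← hq']
    exact hoff _ _ fun h => hmn (Fin.ext h)

end LowRank

/-! ### Banded orthogonal matrices -/

/-- An infinite real orthogonal matrix whose nonzero entries lie on the diagonal or next to it. -/
structure IsBandOrthogonal (E : ℕ → ℕ → ℝ) : Prop where
  rows_band : ∀ a i, a + 1 < i → E a i = 0
  cols_band : ∀ a i, i + 1 < a → E a i = 0
  -- Row `a` vanishes beyond `a + 1`, so this finite sum is the whole inner product, whatever `b`
  -- is.
  rows : ∀ n a b, a + 1 < n → ∑ i ∈ Finset.range n, E a i * E b i = if a = b then 1 else 0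
  cols : ∀ n i j, i + 1 < n → ∑ a ∈ Finset.range n, E a i * E a j = if i = j then 1 else 0

theorem isBandOrthogonal_one : IsBandOrthogonal fun a i => if a = i then 1 else 0 where
  rows_band a i h := if_neg (by omega)
  cols_band a i h := if_neg (by omega)
  rows n a b h := by
    rw [Finset.sum_eq_single a] <;> simp +contextual [eq_comm]
    intro h'; omega
  cols n i j h := by
    rw [Finset.sum_eq_single i] <;> simp +contextual [eq_comm]
    intro h'; omega

theorem blockEntry_even (φ : ℕ → ℝ) (m i : ℕ) :
    blockEntry φ (2 * m) i = if i = 2 * m then Real.cos (φ m / 2)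
      else if i = 2 * m + 1 then Real.sin (φ m / 2) else 0 := by
  simp [blockEntry]

theorem blockEntry_odd (φ : ℕ → ℝ) (m i : ℕ) :
    blockEntry φ (2 * m + 1) i = if i = 2 * m + 1 then Real.cos (φ m / 2)
      else if i = 2 * m then -Real.sin (φ m / 2) else 0 := by
  have h1 : (2 * m + 1) % 2 = 1 := by omega
  have h2 : (2 * m + 1) / 2 = m := by omega
  simp [blockEntry, h1, h2]

/-- Transposing a plane rotation reverses its angle; facts about columns thereby follow from those
about rows. -/
theorem blockEntry_transpose (φ : ℕ → ℝ) (a i : ℕ) :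
    blockEntry φ a i = blockEntry (fun m => -φ m) i a := by
  obtain ⟨m, rfl | rfl⟩ := a.even_or_odd' <;> obtain ⟨n, rfl | rfl⟩ := i.even_or_odd' <;>
    simp only [blockEntry_even, blockEntry_odd, neg_div, Real.cos_neg, Real.sin_neg, neg_neg] <;>
    rcases eq_or_ne m n with rfl | h <;> simp <;> split_ifs <;> first | rfl | omega

theorem blockEntry_band (φ : ℕ → ℝ) {a i : ℕ} (h : a + 1 < i) : blockEntry φ a i = 0 := by
  unfold blockEntry
  split_ifs <;> first | rfl | omega

theorem sum_blockEntry_mul_blockEntry (φ : ℕ → ℝ) {n a : ℕ} (b : ℕ) (h : a + 1 < n) :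
    ∑ i ∈ Finset.range n, blockEntry φ a i * blockEntry φ b i = if a = b then 1 else 0 := by
  obtain ⟨m, hm⟩ : ∃ m, a = 2 * m ∨ a = 2 * m + 1 := a.even_or_odd'
  have hsub : ({2 * m, 2 * m + 1} : Finset ℕ) ⊆ Finset.range n := by
    intro i
    simp only [Finset.mem_insert, Finset.mem_singleton, Finset.mem_range]
    omega
  rw [← Finset.sum_subset hsub, Finset.sum_pair (by omega)]
  · obtain ⟨k, hk⟩ := b.even_or_odd'
    have hcs := Real.sin_sq_add_cos_sq (φ m / 2)
    rcases eq_or_ne m k with rfl | hmk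
    · rcases hm with rfl | rfl <;> rcases hk with rfl | rfl <;>
        simp [blockEntry_even, blockEntry_odd] <;> linarith
    · have h1 : blockEntry φ b (2 * m) = 0 ∧ blockEntry φ b (2 * m + 1) = 0 := by
        rcases hk with rfl | rfl <;> simp only [blockEntry_even, blockEntry_odd] <;>
          constructor <;> split_ifs <;> first | rfl | omega
      rw [h1.1, h1.2, if_neg (by omega)]
      ring
  · intro i _ hi
    simp only [Finset.mem_insert, Finset.mem_singleton, not_or] at hi
    rcases hm with rfl | rfl <;> simp [blockEntry_even, blockEntry_odd, hi]

theorem isBandOrthogonal_blockEntry (φ : ℕ → ℝ) : IsBandOrthogonal (blockEntry φ) where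
  rows_band a i h := blockEntry_band φ h
  cols_band a i h := by rw [blockEntry_transpose, blockEntry_band _ h]
  rows n a b h := sum_blockEntry_mul_blockEntry φ b h
  cols n i j h := by
    simp only [blockEntry_transpose φ]
    exact sum_blockEntry_mul_blockEntry _ j h

/-- The block sum of a `1 × 1` identity matrix and `E`. -/
def shiftEntry (E : ℕ → ℕ → ℝ) (a i : ℕ) : ℝ :=
  if a = 0 then (if i = 0 then 1 else 0) else if i = 0 then 0 else E (a - 1) (i - 1)

theorem IsBandOrthogonal.shiftEntry {E : ℕ → ℕ → ℝ} (hE : IsBandOrthogonal E) :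
    IsBandOrthogonal (shiftEntry E) where
  rows_band a i h := by
    unfold _root_.shiftEntry
    split_ifs
    · omega
    · rfl
    · rfl
    · exact hE.rows_band _ _ (by omega)
  cols_band a i h := by
    unfold _root_.shiftEntry
    split_ifs
    · omega
    · omega
    · rfl
    · exact hE.cols_band _ _ (by omega)
  rows n a b h := by
    obtain ⟨n, rfl⟩ : ∃ k, n = k + 1 := ⟨n - 1, by omega⟩
    rw [Finset.sum_range_succ']
    rcases a with _ | a <;> rcases b with _ | b <;> simp [_root_.shiftEntry]
    exact hE.rows n a b (by omega)
  cols n i j h := by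
    obtain ⟨n, rfl⟩ : ∃ k, n = k + 1 := ⟨n - 1, by omega⟩
    rw [Finset.sum_range_succ']
    rcases i with _ | a <;> rcases j with _ | b <;> simp [_root_.shiftEntry]
    exact hE.cols n a b (by omega)

/-! ### Hilbert bases from banded matrices, and their measurements -/

section HilbertBasis

variable {H : Type u} [NormedAddCommGroup H] [InnerProductSpace ℂ H] [CompleteSpace H]

/-- A banded orthogonal matrix maps a Hilbert basis to a Hilbert basis. -/
theorem IsBandOrthogonal.exists_hilbertBasis {E : ℕ → ℕ → ℝ} (hE : IsBandOrthogonal E)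
    (e : HilbertBasis ℕ ℂ H) :
    ∃ u : HilbertBasis ℕ ℂ H, ∀ a i, ⟪u a, e i⟫_ℂ = E a i := by
  let w : ℕ → H := fun a => ∑ i ∈ Finset.range (a + 2), (E a i : ℂ) • e i
  have hee := orthonormal_iff_ite.1 e.orthonormal
  have hw : ∀ a i, ⟪w a, e i⟫_ℂ = E a i := by
    intro a i
    simp only [w, sum_inner, inner_smul_left, hee, Complex.conj_ofReal, mul_ite, mul_one, mul_zero,
      Finset.sum_ite_eq', Finset.mem_range]
    split_ifs with h
    · rfl
    · rw [hE.rows_band a i (by omega), Complex.ofReal_zero]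
  have hww : Orthonormal ℂ w := by
    rw [orthonormal_iff_ite]
    intro a b
    have h := hE.rows (b + 2) b a (by omega)
    conv_lhs => rhs; simp only [w]
    simp only [inner_sum, inner_smul_right, hw]
    rw [eq_comm] at h
    calc ∑ i ∈ Finset.range (b + 2), (E b i : ℂ) * (E a i : ℂ)
        = ((∑ i ∈ Finset.range (b + 2), E b i * E a i : ℝ) : ℂ) := by push_cast; rfl
      _ = _ := by
          rw [← h]
          rcases eq_or_ne a b with rfl | hab
          · simp
          · simp [hab, hab.symm]
  -- Completeness comes from column orthonormality: $e_j=\sum_a E_{aj}w_a$, so a vector orthogonal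
  -- to every $w_a$ is orthogonal to every $e_j$.
  suffices hbot : (Submodule.span ℂ (Set.range w))ᗮ = ⊥ by
    refine ⟨HilbertBasis.mkOfOrthogonalEqBot hww hbot, fun a i => ?_⟩
    rw [HilbertBasis.coe_mkOfOrthogonalEqBot]
    exact hw a i
  rw [Submodule.eq_bot_iff]
  intro h hh
  have h0 : ∀ a, ⟪w a, h⟫_ℂ = 0 := fun a =>
    (Submodule.mem_orthogonal _ _).1 hh _ (Submodule.subset_span ⟨a, rfl⟩)
  have h1 : ∀ j, ⟪e j, h⟫_ℂ = 0 := by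
    intro j
    -- Column `j` meets only rows `a ≤ j + 1`, whose entries sit at `i ≤ j + 2`; the range `j + 4`
    -- contains them all.
    have h2 : ∀ a ∈ Finset.range (j + 2),
        ∑ i ∈ Finset.range (j + 4), (E a i : ℂ) * ⟪e i, h⟫_ℂ = 0 := by
      intro a ha
      rw [Finset.mem_range] at ha
      rw [← h0 a]
      simp only [w, sum_inner, inner_smul_left, Complex.conj_ofReal]
      symm
      refine Finset.sum_subset (Finset.range_subset_range.2 (by omega)) fun i _ hi => ?_
      rw [Finset.mem_range] at hi
      rw [hE.rows_band a i (by omega), Complex.ofReal_zero, zero_mul]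
    calc ⟪e j, h⟫_ℂ
        = ∑ i ∈ Finset.range (j + 4),
            ((∑ a ∈ Finset.range (j + 2), E a j * E a i : ℝ) : ℂ) * ⟪e i, h⟫_ℂ := by
          rw [Finset.sum_eq_single j]
          · rw [hE.cols (j + 2) j j (by omega)]
            simp
          · intro i _ hi
            rw [hE.cols (j + 2) j i (by omega), if_neg hi.symm]
            simp
          · simp
      _ = ∑ a ∈ Finset.range (j + 2), (E a j : ℂ) *
            ∑ i ∈ Finset.range (j + 4), (E a i : ℂ) * ⟪e i, h⟫_ℂ := by
          push_cast
          simp only [Finset.sum_mul, Finset.mul_sum, mul_assoc]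
          exact Finset.sum_comm
      _ = 0 := Finset.sum_eq_zero fun a ha => by rw [h2 a ha, mul_zero]
  have h3 : e.repr h = 0 := by
    ext i
    rw [e.repr_apply_apply, h1]
    rfl
  simpa using h3

theorem HilbertBasis.isProjectiveMeasurement_rankOne (u : HilbertBasis ℕ ℂ H) :
    IsProjectiveMeasurement fun a => InnerProductSpace.rankOne ℂ (u a) (u a) where
  isStarProjection a := InnerProductSpace.isStarProjection_rankOne_self (u.orthonormal.1 a)
  orthogonal a b hab := by
    ext z
    simp [InnerProductSpace.rankOne_apply, orthonormal_iff_ite.1 u.orthonormal a b, hab]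
  hasSum_apply z := by
    simpa [InnerProductSpace.rankOne_apply, u.repr_apply_apply] using u.hasSum_repr z

end HilbertBasis

/-! ### The state `∑ i, c i • e i ⊗ e i` -/

section State

variable {H : Type u} {K : Type v} [NormedAddCommGroup H] [InnerProductSpace ℂ H]
  [NormedAddCommGroup K] [InnerProductSpace ℂ K]

theorem norm_hilbertTmul (x : H) (y : K) : ‖hilbertTmul x y‖ = ‖x‖ * ‖y‖ := by
  rw [hilbertTmul, UniformSpace.Completion.norm_coe, TensorProduct.norm_tmul]

theorem inner_hilbertTmul (x x' : H) (y y' : K) :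
    ⟪hilbertTmul x y, hilbertTmul x' y'⟫_ℂ = ⟪x, x'⟫_ℂ * ⟪y, y'⟫_ℂ := by
  rw [hilbertTmul, hilbertTmul, UniformSpace.Completion.inner_coe, TensorProduct.inner_tmul]

theorem hilbertTensorMap_hilbertTmul (S : H →L[ℂ] H) (T : K →L[ℂ] K) (x : H) (y : K) :
    hilbertTensorMap S T (hilbertTmul x y) = hilbertTmul (S x) (T y) := by
  rw [hilbertTensorMap, hilbertTmul, ContinuousLinearMap.completion_apply_coe,
    TensorProduct.mapL_tmul]
  rfl

theorem hilbertTmul_smul_smul (a b : ℂ) (x : H) (y : K) :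
    hilbertTmul (a • x) (b • y) = (a * b) • hilbertTmul x y := by
  rw [hilbertTmul, hilbertTmul, TensorProduct.smul_tmul_smul, UniformSpace.Completion.coe_smul]

/-- Absolute summability gives convergence in norm, and pairing `ψ` with its own expansion reduces
$\|\psi\|^2$ to $\sum_i c_i^2$. -/
theorem exists_hasSum_hilbertTmul (e : HilbertBasis ℕ ℂ H) (f : HilbertBasis ℕ ℂ K) {c : ℕ → ℝ}
    (hc : Summable fun i => |c i|) (hc2 : HasSum (fun i => c i ^ 2) 1) :
    ∃ ψ : HilbertTensor H K, HasSum (fun i => (c i : ℂ) • hilbertTmul (e i) (f i)) ψ ∧ ‖ψ‖ = 1 := by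
  have hnorm : ∀ i, ‖(c i : ℂ) • hilbertTmul (e i) (f i)‖ = |c i| := by
    intro i
    rw [norm_smul, norm_hilbertTmul, e.orthonormal.1, f.orthonormal.1]
    simp
  have hs : Summable fun i => (c i : ℂ) • hilbertTmul (e i) (f i) :=
    Summable.of_norm (by simpa only [hnorm] using hc)
  obtain ⟨ψ, hψ⟩ := hs
  refine ⟨ψ, hψ, ?_⟩
  have he := orthonormal_iff_ite.1 e.orthonormal
  have hf := orthonormal_iff_ite.1 f.orthonormal
  have h1 : ∀ i, ⟪hilbertTmul (e i) (f i), ψ⟫_ℂ = c i := by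
    intro i
    have h2 := hψ.mapL (innerSL ℂ (hilbertTmul (e i) (f i)))
    simp only [innerSL_apply_apply, inner_smul_right, inner_hilbertTmul, he, hf] at h2
    refine h2.unique ?_
    refine (hasSum_ite_eq i (c i : ℂ)).congr_fun fun j => ?_
    rcases eq_or_ne i j with rfl | h
    · simp
    · simp [h, h.symm]
  have h3 := hψ.mapL (innerSL ℂ ψ)
  simp only [innerSL_apply_apply, inner_smul_right, inner_self_eq_norm_sq_to_K] at h3
  have h4 : ∀ i, ⟪ψ, hilbertTmul (e i) (f i)⟫_ℂ = c i := by
    intro i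
    rw [← inner_conj_symm, h1, Complex.conj_ofReal]
  have h5 : HasSum (fun i => ((c i ^ 2 : ℝ) : ℂ)) ((‖ψ‖ ^ 2 : ℝ) : ℂ) := by
    simp only [h4] at h3
    rw [Complex.ofReal_pow]
    refine HasSum.congr_fun h3 fun i => ?_
    push_cast
    ring
  have h6 := (Complex.hasSum_ofReal.1 h5).unique hc2
  nlinarith [norm_nonneg ψ]

end State

/-- The correlation obtained by measuring `∑ i, c i • e i ⊗ e i` in the bases given by the rows of
banded orthogonal matrices. -/
theorem bandCorr_mem_Cqs {X Y : Type} {EA : X → ℕ → ℕ → ℝ} {EB : Y → ℕ → ℕ → ℝ}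
    (hA : ∀ x, IsBandOrthogonal (EA x)) (hB : ∀ y, IsBandOrthogonal (EB y)) {c : ℕ → ℝ}
    (hc : Summable fun i => |c i|) (hc2 : HasSum (fun i => c i ^ 2) 1) :
    (fun x y a b => (∑ i ∈ Finset.range (a + 2), c i * EA x a i * EB y b i) ^ 2) ∈
      Cqs.{0, 0} X Y ℕ ℕ := by
  -- The standard basis of $\ell^2$.
  let e : HilbertBasis ℕ ℂ (lp (fun _ : ℕ => ℂ) 2) := ⟨LinearIsometryEquiv.refl ℂ _⟩
  choose uA huA using fun x => (hA x).exists_hilbertBasis e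
  choose uB huB using fun y => (hB y).exists_hilbertBasis e
  obtain ⟨ψ, hψ, hψ1⟩ := exists_hasSum_hilbertTmul e e hc hc2
  refine ⟨lp (fun _ : ℕ => ℂ) 2, inferInstance, inferInstance, inferInstance,
    lp (fun _ : ℕ => ℂ) 2, inferInstance, inferInstance, inferInstance,
    { state := ψ
      norm_state := hψ1
      alice := fun x a => InnerProductSpace.rankOne ℂ (uA x a) (uA x a)
      bob := fun y b => InnerProductSpace.rankOne ℂ (uB y b) (uB y b)
      alice_isPVM := fun x => (uA x).isProjectiveMeasurement_rankOne
      bob_isPVM := fun y => (uB y).isProjectiveMeasurement_rankOne }, ?_⟩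
  intro x y a b
  simp only
  set s : ℝ := ∑ i ∈ Finset.range (a + 2), c i * EA x a i * EB y b i with hs
  have hsum : HasSum (fun i => ((c i * EA x a i * EB y b i : ℝ) : ℂ)) (s : ℂ) := by
    rw [Complex.hasSum_ofReal]
    refine hasSum_sum_of_ne_finset_zero fun i hi => ?_
    rw [Finset.mem_range] at hi
    rw [(hA x).rows_band a i (by omega), mul_zero, zero_mul]
  have h1 : ⟪hilbertTmul (uA x a) (uB y b), ψ⟫_ℂ = s := by
    have h := hψ.mapL (innerSL ℂ (hilbertTmul (uA x a) (uB y b)))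
    simp only [innerSL_apply_apply, inner_smul_right, inner_hilbertTmul, huA, huB] at h
    refine h.unique ?_
    refine HasSum.congr_fun hsum fun i => ?_
    push_cast
    ring
  have h2 : hilbertTensorMap (InnerProductSpace.rankOne ℂ (uA x a) (uA x a))
      (InnerProductSpace.rankOne ℂ (uB y b) (uB y b)) ψ =
      (s : ℂ) • hilbertTmul (uA x a) (uB y b) := by
    have h := hψ.mapL (hilbertTensorMap (InnerProductSpace.rankOne ℂ (uA x a) (uA x a))
      (InnerProductSpace.rankOne ℂ (uB y b) (uB y b)))
    simp only [map_smul, hilbertTensorMap_hilbertTmul, InnerProductSpace.rankOne_apply, huA, huB,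
      hilbertTmul_smul_smul, smul_smul] at h
    refine h.unique ?_
    refine HasSum.congr_fun (hsum.smul_const (hilbertTmul (uA x a) (uB y b))) fun i => ?_
    push_cast
    rw [mul_assoc]
  rw [h2, inner_smul_right, ← inner_conj_symm, h1, Complex.conj_ofReal]
  push_cast
  ring

/-! ### The ideal correlations and their limit -/

/-- Coordinates of the infinite-dimensional analogues of Alice's measurement bases. -/
noncomputable def aliceEntry : Fin 3 → ℕ → ℕ → ℝ :=
  ![fun a i => if a = i then 1 else 0, blockEntry fun _ => Real.pi / 2,
    shiftEntry (blockEntry fun _ => Real.pi / 2)]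

/-- Coordinates of the infinite-dimensional analogues of Bob's measurement bases. -/
noncomputable def bobEntry (c : ℕ → ℝ) : Fin 4 → ℕ → ℕ → ℝ :=
  ![blockEntry (angleMu c), blockEntry fun m => -angleMu c m,
    shiftEntry (blockEntry (angleMu' c)), shiftEntry (blockEntry fun m => -angleMu' c m)]

theorem isBandOrthogonal_aliceEntry (x : Fin 3) : IsBandOrthogonal (aliceEntry x) := by
  fin_cases x
  · exact isBandOrthogonal_one
  · exact isBandOrthogonal_blockEntry fun _ => Real.pi / 2
  · exact (isBandOrthogonal_blockEntry fun _ => Real.pi / 2).shiftEntry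

theorem isBandOrthogonal_bobEntry (c : ℕ → ℝ) (y : Fin 4) : IsBandOrthogonal (bobEntry c y) := by
  fin_cases y
  · exact isBandOrthogonal_blockEntry (angleMu c)
  · exact isBandOrthogonal_blockEntry fun m => -angleMu c m
  · exact (isBandOrthogonal_blockEntry (angleMu' c)).shiftEntry
  · exact (isBandOrthogonal_blockEntry fun m => -angleMu' c m).shiftEntry

theorem ket_apply {d : ℕ} (a i : Fin d) : ket a i = ((if (a : ℕ) = i then 1 else 0 : ℝ) : ℂ) := by
  rw [ket, PiLp.single_apply]
  rcases eq_or_ne a i with rfl | h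
  · simp
  · rw [if_neg h.symm, if_neg (fun h' => h (Fin.ext h')), Complex.ofReal_zero]

/-- Label $2K$ is excluded because the truncation cuts the block $\{2K,2K+1\}$ and puts $|2K\rangle$
there. -/
theorem blockVec_apply {K : ℕ} (φ : ℕ → ℝ) {a : Fin (2 * K + 1)} (ha : (a : ℕ) < 2 * K)
    (i : Fin (2 * K + 1)) : blockVec K φ a i = (blockEntry φ a i : ℂ) := by
  rw [blockVec, if_neg ha.ne]

theorem shiftedBlockVec_apply {K : ℕ} (φ : ℕ → ℝ) (a i : Fin (2 * K + 1)) :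
    shiftedBlockVec K φ a i = (shiftEntry (blockEntry φ) a i : ℂ) := by
  rw [shiftedBlockVec, shiftEntry]
  split_ifs with h1 h2 h2
  · rw [ket_apply, if_pos (h1.trans h2.symm)]
  · rw [ket_apply, if_neg (fun h => h2 (h.symm.trans h1))]
  · simp [h2]
  · simp [h2]

theorem aliceBasis_apply {K : ℕ} (x : Fin 3) {a : Fin (2 * K + 1)} (ha : (a : ℕ) < 2 * K)
    (i : Fin (2 * K + 1)) : aliceBasis K x a i = (aliceEntry x a i : ℂ) := by
  fin_cases x
  · exact ket_apply a i
  · exact blockVec_apply _ ha i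
  · exact shiftedBlockVec_apply _ a i

theorem bobBasis_apply {K : ℕ} (c : ℕ → ℝ) (y : Fin 4) {b : Fin (2 * K + 1)}
    (hb : (b : ℕ) < 2 * K) (i : Fin (2 * K + 1)) :
    bobBasis K c y b i = (bobEntry c y b i : ℂ) := by
  fin_cases y
  · exact blockVec_apply _ hb i
  · exact blockVec_apply _ hb i
  · exact shiftedBlockVec_apply _ b i
  · exact shiftedBlockVec_apply _ b i

theorem idealCorr_eq {K : ℕ} (c : ℕ → ℝ) (x : Fin 3) (y : Fin 4) {a b : Fin (2 * K + 1)}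
    (ha : (a : ℕ) < 2 * K) (hb : (b : ℕ) < 2 * K) :
    idealCorr K c x y a b =
      (∑ i ∈ Finset.range (a + 2), c i * aliceEntry x a i * bobEntry c y b i) ^ 2 := by
  have h1 : ⟪aliceBasis K x a ⊗ₜ[ℂ] bobBasis K c y b, idealState K c⟫_ℂ =
      ((∑ i ∈ Finset.range (a + 2), c i * aliceEntry x a i * bobEntry c y b i : ℝ) : ℂ) := by
    rw [idealState, inner_sum]
    have h2 : ∑ i ∈ Finset.range (a + 2), c i * aliceEntry x a i * bobEntry c y b i =
        ∑ i ∈ Finset.range (2 * K + 1), c i * aliceEntry x a i * bobEntry c y b i := by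
      refine Finset.sum_subset (Finset.range_subset_range.2 (by omega)) fun i _ hi => ?_
      rw [Finset.mem_range] at hi
      rw [(isBandOrthogonal_aliceEntry x).rows_band a i (by omega), mul_zero, zero_mul]
    rw [h2, Finset.sum_range, Complex.ofReal_sum]
    refine Finset.sum_congr rfl fun i _ => ?_
    refine (inner_smul_right (𝕜 := ℂ) (aliceBasis K x a ⊗ₜ[ℂ] bobBasis K c y b)
      (ket i ⊗ₜ[ℂ] ket i) (c i : ℂ)).trans ?_
    rw [TensorProduct.inner_tmul]
    simp only [ket, EuclideanSpace.inner_single_right, aliceBasis_apply x ha,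
      bobBasis_apply c y hb, Complex.conj_ofReal]
    push_cast
    ring
  rw [idealCorr, h1, Complex.norm_real, Real.norm_eq_abs, sq_abs]

/-- The coefficients of the limit state. -/
noncomputable def limitCoeff (i : ℕ) : ℝ :=
  (1 / ((i : ℝ) + 1) ^ 8) / √(∑' j : ℕ, 1 / ((j : ℝ) + 1) ^ 16)

theorem summable_one_div_add_one_pow {k : ℕ} (hk : 1 < k) :
    Summable fun j : ℕ => 1 / ((j : ℝ) + 1) ^ k := by
  have := (summable_nat_add_iff 1).2 (Real.summable_one_div_nat_pow.2 hk)
  simpa using this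

theorem tsum_one_div_add_one_pow_pos : 0 < ∑' j : ℕ, 1 / ((j : ℝ) + 1) ^ 16 :=
  (summable_one_div_add_one_pow (by norm_num)).tsum_pos (fun j => by positivity) 0 (by norm_num)

theorem limitCoeff_sq (i : ℕ) :
    limitCoeff i ^ 2 = 1 / ((i : ℝ) + 1) ^ 16 / ∑' j : ℕ, 1 / ((j : ℝ) + 1) ^ 16 := by
  rw [limitCoeff, div_pow, Real.sq_sqrt tsum_one_div_add_one_pow_pos.le, div_pow, one_pow, ← pow_mul]

theorem hasSum_limitCoeff_sq : HasSum (fun i => limitCoeff i ^ 2) 1 := by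
  simp only [limitCoeff_sq]
  have h := (summable_one_div_add_one_pow (k := 16) (by norm_num)).hasSum.div_const
    (∑' j : ℕ, 1 / ((j : ℝ) + 1) ^ 16)
  rwa [div_self tsum_one_div_add_one_pow_pos.ne'] at h

theorem summable_abs_limitCoeff : Summable fun i => |limitCoeff i| :=
  ((summable_one_div_add_one_pow (k := 8) (by norm_num)).div_const _).abs

theorem tendsto_powerCoeff (i : ℕ) :
    Filter.Tendsto (fun d => powerCoeff d i) Filter.atTop (nhds (limitCoeff i)) := by
  have h := (summable_one_div_add_one_pow (k := 16) (by norm_num)).hasSum.tendsto_sum_nat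
  exact tendsto_const_nhds.div ((Real.continuous_sqrt.tendsto _).comp h)
    (Real.sqrt_pos.2 tsum_one_div_add_one_pow_pos).ne'

/-- The normalization cancels in ratios, which makes Bob's angles independent of `d`. -/
theorem powerCoeff_div_powerCoeff {d : ℕ} (hd : 0 < d) (i j : ℕ) :
    powerCoeff d i / powerCoeff d j = limitCoeff i / limitCoeff j := by
  have h1 : √(∑ j ∈ Finset.range d, 1 / ((j : ℝ) + 1) ^ 16) ≠ 0 := by
    refine (Real.sqrt_pos.2 (Finset.sum_pos (fun j _ => by positivity) ?_)).ne'
    simpa using hd.ne'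
  have h2 : √(∑' j : ℕ, 1 / ((j : ℝ) + 1) ^ 16) ≠ 0 :=
    (Real.sqrt_pos.2 tsum_one_div_add_one_pow_pos).ne'
  rw [powerCoeff, powerCoeff, limitCoeff, limitCoeff, div_div_div_cancel_right₀ h1,
    div_div_div_cancel_right₀ h2]

theorem bobEntry_powerCoeff {d : ℕ} (hd : 0 < d) : bobEntry (powerCoeff d) = bobEntry limitCoeff := by
  have h1 : angleMu (powerCoeff d) = angleMu limitCoeff := by
    ext m
    rw [angleMu, angleMu, powerCoeff_div_powerCoeff hd]
  have h2 : angleMu' (powerCoeff d) = angleMu' limitCoeff := by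
    ext m
    rw [angleMu', angleMu', powerCoeff_div_powerCoeff hd]
  rw [bobEntry, bobEntry, h1, h2]

/-- The limit correlation. -/
noncomputable def limitCorr (x : Fin 3) (y : Fin 4) (a b : ℕ) : ℝ :=
  (∑ i ∈ Finset.range (a + 2), limitCoeff i * aliceEntry x a i * bobEntry limitCoeff y b i) ^ 2

theorem limitCorr_mem_Cqs : limitCorr ∈ Cqs.{0, 0} (Fin 3) (Fin 4) ℕ ℕ :=
  bandCorr_mem_Cqs isBandOrthogonal_aliceEntry (isBandOrthogonal_bobEntry limitCoeff)
    summable_abs_limitCoeff hasSum_limitCoeff_sq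

theorem tendsto_liftCorr_idealCorr (x : Fin 3) (y : Fin 4) (a b : ℕ) :
    Filter.Tendsto (fun K : ℕ => liftCorr (idealCorr K (powerCoeff (2 * K + 1))) x y a b)
      Filter.atTop (nhds (limitCorr x y a b)) := by
  have h1 : Filter.Tendsto (fun K : ℕ => (∑ i ∈ Finset.range (a + 2),
      powerCoeff (2 * K + 1) i * aliceEntry x a i * bobEntry limitCoeff y b i) ^ 2)
      Filter.atTop (nhds (limitCorr x y a b)) := by
    refine (tendsto_finsetSum _ fun i _ => ?_).pow 2
    refine Filter.Tendsto.mul_const _ (Filter.Tendsto.mul_const _ ?_)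
    refine (tendsto_powerCoeff i).comp (Filter.tendsto_atTop_mono (fun K => ?_) Filter.tendsto_id)
    simp only [id]
    omega
  refine h1.congr' ?_
  -- Both labels are then below `2 * K`, clear of the exceptional last outcome.
  filter_upwards [Filter.eventually_gt_atTop (a + b)] with K hK
  rw [liftCorr, dif_pos ⟨by omega, by omega⟩, idealCorr_eq _ _ _ (by simp only; omega)
    (by simp only; omega), bobEntry_powerCoeff (by omega)]

/-! ### The limit correlation on even answers to the questions (0, 0) -/

theorem limitCorr_zero_zero (a b : ℕ) :
    limitCorr 0 0 a b = (limitCoeff a * blockEntry (angleMu limitCoeff) b a) ^ 2 := by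
  rw [limitCorr, Finset.sum_eq_single a]
  · simp [aliceEntry, bobEntry]
  · intro i _ hi
    simp [aliceEntry, hi.symm]
  · intro h
    simp at h

theorem limitCorr_even_even_of_ne {m n : ℕ} (h : m ≠ n) :
    limitCorr 0 0 (2 * m) (2 * n) = 0 := by
  rw [limitCorr_zero_zero, blockEntry_even, if_neg (by omega), if_neg (by omega)]
  simp

/-- Here $\cos^2(\mu_m/2)=(1+\cos\mu_m)/2\ge 1/2$, because $\mu_m$ is an arctangent and has positive
cosine. -/
theorem le_limitCorr_even_even (m : ℕ) :
    limitCoeff (2 * m) ^ 2 / 2 ≤ limitCorr 0 0 (2 * m) (2 * m) := by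
  rw [limitCorr_zero_zero, blockEntry_even, if_pos rfl, mul_pow, Real.cos_sq, mul_div_cancel₀ _
    (two_ne_zero), div_eq_mul_one_div]
  have h : 0 < Real.cos (angleMu limitCoeff m) := Real.cos_arctan_pos _
  gcongr
  linarith

/-! ### The lower bound on the Schmidt rank -/

theorem abs_sub_le_of_corrDist_le {X Y A B : Type} {p p' : X → Y → A → B → ℝ} {δ : ℝ} (hδ : 0 ≤ δ)
    (h : corrDist p p' ≤ ENNReal.ofReal δ) (x : X) (y : Y) (a : A) (b : B) :
    |p x y a b - p' x y a b| ≤ δ := by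
  refine (ENNReal.ofReal_le_ofReal_iff hδ).1 (le_trans ?_ h)
  refine le_trans ?_ (le_iSup₂ (f := fun (x : X) (y : Y) =>
    ∑' ab : A × B, ENNReal.ofReal |p x y ab.1 ab.2 - p' x y ab.1 ab.2|) x y)
  exact ENNReal.le_tsum (f := fun ab : A × B =>
    ENNReal.ofReal |p x y ab.1 ab.2 - p' x y ab.1 ab.2|) (a, b)

theorem SchmidtRankLE.pos {H : Type u} {K : Type v} [NormedAddCommGroup H] [InnerProductSpace ℂ H]
    [NormedAddCommGroup K] [InnerProductSpace ℂ K] {ψ : HilbertTensor H K} {N : ℕ}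
    (h : SchmidtRankLE ψ N) (hψ : ‖ψ‖ = 1) : 0 < N := by
  obtain ⟨r, hr, lam, e, f, -, -, -, rfl⟩ := h
  rcases r with _ | r
  · simp at hψ
  · omega

theorem limitCoeff_sq_le_of_corrDist_le {N : ℕ} {δ : ℝ} {p : Fin 3 → Fin 4 → ℕ → ℕ → ℝ}
    (hδ : 0 < δ) (hp : p ∈ CqLE.{u, v} (Fin 3) (Fin 4) ℕ ℕ N)
    (h : corrDist p limitCorr ≤ ENNReal.ofReal δ) :
    0 < N ∧ limitCoeff (2 * N) ^ 2 / 2 ≤ (N ^ 3 + 1) * δ := by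
  obtain ⟨H, _, _, _, K, _, _, _, S, hS, hSp⟩ := hp
  refine ⟨hS.pos S.norm_state, ?_⟩
  have hclose := abs_sub_le_of_corrDist_le hδ.le h 0 0
  have hmono : ∀ m ≤ N, limitCoeff (2 * N) ^ 2 ≤ limitCoeff (2 * m) ^ 2 := by
    intro m hm
    have := tsum_one_div_add_one_pow_pos
    rw [limitCoeff_sq, limitCoeff_sq]
    gcongr
  have := diagonal_le_of_schmidtRankLE hS (fun m => S.alice 0 (2 * m)) (fun m => S.bob 0 (2 * m))
    (fun m => (S.alice_isPVM 0).isStarProjection _) (fun m => (S.bob_isPVM 0).isStarProjection _)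
    (fun m n => p 0 0 (2 * m) (2 * n)) (fun m n => hSp 0 0 _ _) hδ.le
    -- The coefficients decrease, so among the $N+1$ diagonal entries the bound is weakest at `m =
    -- N`; `δ` is the error of one entry.
    (w := limitCoeff (2 * N) ^ 2 / 2 - δ)
    (fun m hm => by
      have h1 := (abs_le.1 (hclose (2 * m) (2 * m))).1
      have h2 := le_limitCorr_even_even m
      have h3 := hmono m hm
      linarith)
    (fun m n hmn => by
      have h1 := (abs_le.1 (hclose (2 * m) (2 * n))).2
      rw [limitCorr_even_even_of_ne hmn] at h1
      linarith)
  linarith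

theorem theorem1 :
    ∃ pstar : Fin 3 → Fin 4 → ℕ → ℕ → ℝ,
      pstar ∈ Cqs.{0, 0} (Fin 3) (Fin 4) ℕ ℕ ∧
      (∀ (x : Fin 3) (y : Fin 4) (a b : ℕ),
        Filter.Tendsto
          (fun K : ℕ => liftCorr (idealCorr K (powerCoeff (2 * K + 1))) x y a b)
          Filter.atTop (nhds (pstar x y a b))) ∧
      ∃ C : ℝ, 0 < C ∧
        ∀ (N : ℕ) (δ : ℝ) (p : Fin 3 → Fin 4 → ℕ → ℕ → ℝ), 0 < δ →
          p ∈ CqLE.{u, v} (Fin 3) (Fin 4) ℕ ℕ N →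
          corrDist p pstar ≤ ENNReal.ofReal δ →
          C * (1 / δ ^ ((1 : ℝ) / 32)) ≤ (N : ℝ) := by
  refine ⟨limitCorr, limitCorr_mem_Cqs, tendsto_liftCorr_idealCorr, ?_⟩
  set Z : ℝ := ∑' j : ℕ, 1 / ((j : ℝ) + 1) ^ 16 with hZ
  have hZ0 : 0 < Z := tsum_one_div_add_one_pow_pos
  -- From $2N+1\le 3N$ and $N^3+1\le 2N^3$ one gets $1/(4\cdot 3^{16}Z)\le N^{19}\delta$. As $N\ge
  -- 1$, the exponent 19 may be raised to 32.
  refine ⟨(1 / (4 * 3 ^ 16 * Z)) ^ ((1 : ℝ) / 32), by positivity, fun N δ p hδ hp hdist => ?_⟩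
  obtain ⟨hN, hle⟩ := limitCoeff_sq_le_of_corrDist_le hδ hp hdist
  rw [limitCoeff_sq, ← hZ] at hle
  have hN1 : (1 : ℝ) ≤ N := by exact_mod_cast hN
  have hpow : (N : ℝ) ^ 3 * (N : ℝ) ^ 16 ≤ (N : ℝ) ^ 32 := by
    rw [← pow_add]
    exact pow_le_pow_right₀ hN1 (by norm_num)
  have h1 : 1 / (3 * (N : ℝ)) ^ 16 / Z / 2 ≤ 2 * N ^ 3 * δ := by
    calc 1 / (3 * (N : ℝ)) ^ 16 / Z / 2 ≤ 1 / (((2 * N : ℕ) : ℝ) + 1) ^ 16 / Z / 2 := by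
          gcongr
          push_cast
          linarith
      _ ≤ (N ^ 3 + 1) * δ := hle
      _ ≤ 2 * N ^ 3 * δ := by
          have := one_le_pow₀ (n := 3) hN1
          gcongr
          linarith
  have h2 : 1 / (4 * 3 ^ 16 * Z) ≤ (N : ℝ) ^ 32 * δ := by
    have h3 : 1 / (4 * 3 ^ 16 * Z) =
        1 / (3 * (N : ℝ)) ^ 16 / Z / 2 * ((N : ℝ) ^ 16 / 2) := by
      field_simp
      norm_num
    calc 1 / (4 * 3 ^ 16 * Z) = 1 / (3 * (N : ℝ)) ^ 16 / Z / 2 * ((N : ℝ) ^ 16 / 2) := h3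
      _ ≤ 2 * N ^ 3 * δ * ((N : ℝ) ^ 16 / 2) := by gcongr
      _ = (N : ℝ) ^ 3 * (N : ℝ) ^ 16 * δ := by ring
      _ ≤ (N : ℝ) ^ 32 * δ := by gcongr
  have h4 : (1 / (4 * 3 ^ 16 * Z)) ^ ((1 : ℝ) / 32) ≤ N * δ ^ ((1 : ℝ) / 32) := by
    refine (Real.rpow_le_rpow (by positivity) h2 (by norm_num)).trans_eq ?_
    rw [Real.mul_rpow (by positivity) hδ.le]
    congr 1
    rw [← Real.rpow_natCast, ← Real.rpow_mul (by positivity)]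
    norm_num
  rw [mul_one_div, div_le_iff₀ (by positivity)]
  exact h4
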